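/- Let Alice and Bob share two-qubit states, i.e. positive semidefinite trace-one operators $\rho$ on $\mathbb C^2\otimes\mathbb C^2$, with Bob's reduced state $\rho_B=\mathrm{tr}_A\,\rho$. For a POVM element $M$ on Alice's qubit ($0\le M\le \mathbb 1$) with outcome probability $p_M=\mathrm{tr}[(M\otimes\mathbb 1)\rho]>0$, Bob's state is steered to $\rho_B^M=\mathrm{tr}_A[(M\otimes\mathbb 1)\rho]/p_M$. The coherence of a qubit state $\sigma$ in an orthonormal basis $\Xi=\{|\xi_1\rangle,|\xi_2\rangle\}$ is $C(\sigma,\Xi)=\sum_{i\ne j}|\langle\xi_i|\sigma|\xi_j\rangle|$. The maximal steered coherence of $\rho$ is $$\mathcal C(\rho)=\inf_{\Xi}\ \max_{M:\,p_M>0}\ C(\rho_B^M,\Xi),$$ where $\Xi$ runs over the orthonormal eigenbases of $\rho_B$ (when $\rho_B$ is non-degenerate, $\Xi$ is unique up to order and phases, and the infimum is over a single value). Theorem. Let $\Lambda_B$ be a qubit channel (a completely positive trace-preserving linear map on $2\times 2$ complex matrices). There exists a two-qubit state $\rho$ with $$\mathcal C\big((\mathrm{id}_A\otimes\Lambda_B)(\rho)\big)>\mathcal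 C(\rho)$$ if and only if $\Lambda_B$ is neither unital nor semi-classical. Here $\Lambda_B$ is unital if $\Lambda_B(\mathbb 1)=\mathbb 1$, and semi-classical if there is an orthonormal basis $\{|k\rangle\}$ of $\mathbb C^2$, independent of the input, such that $\Lambda_B(\sigma)$ is diagonal in $\{|k\rangle\}$ for every qubit state $\sigma$. -/

import Mathlib

open scoped Kronecker ComplexOrder

namespace SteeredCoherence

variable {a n : Type*} [Fintype a] [Fintype n] [DecidableEq a] [DecidableEq n]

/-- A quantum state: a positive semidefinite matrix of trace one. -/
def IsState (σ : Matrix n n ℂ) : Prop :=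
  σ.PosSemidef ∧ σ.trace = 1

/-- An operator occurring as an element of some POVM, i.e. `0 ≤ M ≤ 1`
(every such `M` belongs to the POVM `{M, 1 - M}`). -/
def IsPOVMElement (M : Matrix a a ℂ) : Prop :=
  M.PosSemidef ∧ (1 - M).PosSemidef

/-- The partial trace over the first (Alice's) tensor factor. -/
def trA (X : Matrix (a × n) (a × n) ℂ) : Matrix n n ℂ :=
  Matrix.of fun k l => ∑ i, X (i, k) (i, l)

/-- The probability `p_M = tr ((M ⊗ 1) ρ)` of the outcome `M` on Alice's side. -/
noncomputable def outcomeProb (ρ : Matrix (a × n) (a × n) ℂ) (M : Matrix a a ℂ) : ℝ :=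
  ((M ⊗ₖ (1 : Matrix n n ℂ)) * ρ).trace.re

/-- Bob's state after Alice's outcome `M` of nonzero probability: `tr_A ((M ⊗ 1) ρ) / p_M`. -/
noncomputable def steeredState (ρ : Matrix (a × n) (a × n) ℂ) (M : Matrix a a ℂ) :
    Matrix n n ℂ :=
  ((outcomeProb ρ M : ℂ))⁻¹ • trA ((M ⊗ₖ (1 : Matrix n n ℂ)) * ρ)

/-- The coherence of `σ` in the orthonormal basis `ξ`: the sum of the absolute values of the
off-diagonal matrix elements `⟨ξ_i|σ|ξ_j⟩`. -/
noncomputable def coherence (σ : Matrix n n ℂ) (ξ : OrthonormalBasis n ℂ (EuclideanSpace ℂ n)) :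
    ℝ :=
  ∑ i, ∑ j, if i = j then 0 else ‖inner ℂ (ξ i) (Matrix.toEuclideanLin σ (ξ j))‖

/-- `ξ` is an orthonormal basis of eigenvectors of `σ`. -/
def IsEigenbasis (σ : Matrix n n ℂ) (ξ : OrthonormalBasis n ℂ (EuclideanSpace ℂ n)) : Prop :=
  ∀ i, ∃ μ : ℂ, Matrix.toEuclideanLin σ (ξ i) = μ • ξ i

/-- The largest coherence, in the basis `ξ`, of the states to which Alice can steer Bob. -/
noncomputable def maxSteeredCoherenceIn (ρ : Matrix (a × n) (a × n) ℂ)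
    (ξ : OrthonormalBasis n ℂ (EuclideanSpace ℂ n)) : ℝ :=
  sSup {c | ∃ M : Matrix a a ℂ, IsPOVMElement M ∧ 0 < outcomeProb ρ M ∧
    c = coherence (steeredState ρ M) ξ}

/-- The maximal steered coherence: the infimum, over the eigenbases `ξ` of Bob's reduced state,
of the largest steered coherence in the basis `ξ`. If the reduced state is non-degenerate, its
eigenbasis is unique up to order and phases, on which the coherence does not depend, and the
infimum is over a single value. -/
noncomputable def maxSteeredCoherence (ρ : Matrix (a × n) (a × n) ℂ) : ℝ :=
  sInf {c | ∃ ξ : OrthonormalBasis n ℂ (EuclideanSpace ℂ n), IsEigenbasis (trA ρ) ξ ∧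
    c = maxSteeredCoherenceIn ρ ξ}

/-- The action of `1_A ⊗ Λ` : the map `Λ` is applied to each Bob block of the matrix. -/
def applyB (a : Type*) (Λ : Matrix n n ℂ →ₗ[ℂ] Matrix n n ℂ) (X : Matrix (a × n) (a × n) ℂ) :
    Matrix (a × n) (a × n) ℂ :=
  Matrix.of fun p q => Λ (Matrix.of fun k l => X (p.1, k) (q.1, l)) p.2 q.2

/-- A quantum channel: a completely positive trace-preserving linear map. -/
structure IsChannel (Λ : Matrix n n ℂ →ₗ[ℂ] Matrix n n ℂ) : Prop where
  completelyPositive : ∀ (d : ℕ) (X : Matrix (Fin d × n) (Fin d × n) ℂ),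
    X.PosSemidef → (applyB (Fin d) Λ X).PosSemidef
  tracePreserving : ∀ X : Matrix n n ℂ, (Λ X).trace = X.trace

/-- A unital map fixes the identity. -/
def IsUnital (Λ : Matrix n n ℂ →ₗ[ℂ] Matrix n n ℂ) : Prop :=
  Λ 1 = 1

/-- A semi-classical map sends every state to one with zero coherence in one fixed basis. -/
def IsSemiClassical (Λ : Matrix n n ℂ →ₗ[ℂ] Matrix n n ℂ) : Prop :=
  ∃ ξ : OrthonormalBasis n ℂ (EuclideanSpace ℂ n),
    ∀ σ : Matrix n n ℂ, IsState σ → coherence (Λ σ) ξ = 0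

end SteeredCoherence

namespace SteeredCoherence

open Matrix

set_option linter.unusedSectionVars false

/-! ### Matrices in an orthonormal basis -/

section General

variable {a n : Type*} [Fintype a] [Fintype n] [DecidableEq a] [DecidableEq n]

/-! Applying the channel commutes with steering, so only the choice of basis matters. A
semi-classical channel makes every steered state diagonal in one fixed basis, which is then an
eigenbasis of Bob's output, and the steered coherence vanishes.

For a unital channel, `Λ` carries the matrices diagonal in `ξ` into those diagonal in a suitable
`η`. Hence the coherence of `Λ σ` in `η` depends only on the off-diagonal part of `σ` in `ξ`.
Replacing `σ` by a positive `Y` with that off-diagonal part and trace equal to the coherence gives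
the bound, as trace is preserved and coherence is at most the trace (`IsUnital.coherence_map_le`).

Otherwise `Λ (1/2)` is nondegenerate, and some `Λ σ` is not diagonal in its eigenbasis. An equal
mixture preparing `σ` or `1 - σ` has reduced state `1/2`; the infimum may use an eigenbasis of `σ`,
so its steered coherence is zero. After the channel that freedom is gone, and steering to `Λ σ`
shows coherence. -/

/-- The unitary matrix whose columns are the vectors of an orthonormal basis. -/
noncomputable def basisMatrix (ξ : OrthonormalBasis n ℂ (EuclideanSpace ℂ n)) : Matrix n n ℂ :=
  Matrix.of fun k i => ξ i k

/-- The matrix of `σ` in the orthonormal basis `ξ`. -/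
noncomputable def inBasis (ξ : OrthonormalBasis n ℂ (EuclideanSpace ℂ n)) (σ : Matrix n n ℂ) :
    Matrix n n ℂ :=
  (basisMatrix ξ)ᴴ * σ * basisMatrix ξ

theorem conjTranspose_basisMatrix_mul_self (ξ : OrthonormalBasis n ℂ (EuclideanSpace ℂ n)) :
    (basisMatrix ξ)ᴴ * basisMatrix ξ = 1 := by
  ext i j
  have h := orthonormal_iff_ite.mp ξ.orthonormal i j
  rw [PiLp.inner_apply] at h
  simp only [Matrix.mul_apply, conjTranspose_apply, basisMatrix, of_apply, Matrix.one_apply]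
  rw [← h]
  refine Finset.sum_congr rfl fun k _ => ?_
  simp [mul_comm]

theorem basisMatrix_mul_conjTranspose_self (ξ : OrthonormalBasis n ℂ (EuclideanSpace ℂ n)) :
    basisMatrix ξ * (basisMatrix ξ)ᴴ = 1 :=
  mul_eq_one_comm.mp (conjTranspose_basisMatrix_mul_self ξ)

theorem inner_toEuclideanLin_eq_inBasis (ξ : OrthonormalBasis n ℂ (EuclideanSpace ℂ n))
    (σ : Matrix n n ℂ) (i j : n) :
    inner ℂ (ξ i) (Matrix.toEuclideanLin σ (ξ j)) = inBasis ξ σ i j := by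
  rw [PiLp.inner_apply]
  simp only [inBasis, Matrix.mul_assoc]
  rw [Matrix.mul_apply]
  refine Finset.sum_congr rfl fun k _ => ?_
  simp [basisMatrix, Matrix.mul_apply, Matrix.mulVec, dotProduct, mul_comm]

theorem isEigenbasis_iff {ξ : OrthonormalBasis n ℂ (EuclideanSpace ℂ n)} {σ : Matrix n n ℂ} :
    IsEigenbasis σ ξ ↔ ∀ i j, i ≠ j → inBasis ξ σ i j = 0 := by
  constructor
  · intro h i j hij
    obtain ⟨μ, hμ⟩ := h j
    rw [← inner_toEuclideanLin_eq_inBasis, hμ, inner_smul_right,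
      orthonormal_iff_ite.mp ξ.orthonormal, if_neg hij, mul_zero]
  · intro h j
    refine ⟨inBasis ξ σ j j, ?_⟩
    rw [← ξ.sum_repr' (toEuclideanLin σ (ξ j)), Finset.sum_eq_single j]
    · rw [inner_toEuclideanLin_eq_inBasis]
    · intro i _ hij
      rw [inner_toEuclideanLin_eq_inBasis, h i j hij, zero_smul]
    · simp

theorem inBasis_add (ξ : OrthonormalBasis n ℂ (EuclideanSpace ℂ n)) (σ τ : Matrix n n ℂ) :
    inBasis ξ (σ + τ) = inBasis ξ σ + inBasis ξ τ := by
  simp [inBasis, Matrix.mul_add, Matrix.add_mul]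

theorem inBasis_sub (ξ : OrthonormalBasis n ℂ (EuclideanSpace ℂ n)) (σ τ : Matrix n n ℂ) :
    inBasis ξ (σ - τ) = inBasis ξ σ - inBasis ξ τ := by
  simp [inBasis, Matrix.mul_sub, Matrix.sub_mul]

theorem inBasis_smul (ξ : OrthonormalBasis n ℂ (EuclideanSpace ℂ n)) (c : ℂ)
    (σ : Matrix n n ℂ) : inBasis ξ (c • σ) = c • inBasis ξ σ := by
  simp [inBasis]

theorem inBasis_one (ξ : OrthonormalBasis n ℂ (EuclideanSpace ℂ n)) :
    inBasis ξ (1 : Matrix n n ℂ) = 1 := by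
  simp [inBasis, conjTranspose_basisMatrix_mul_self]

theorem inBasis_mul (ξ : OrthonormalBasis n ℂ (EuclideanSpace ℂ n)) (σ τ : Matrix n n ℂ) :
    inBasis ξ (σ * τ) = inBasis ξ σ * inBasis ξ τ := by
  calc inBasis ξ (σ * τ)
      = (basisMatrix ξ)ᴴ * σ * (basisMatrix ξ * (basisMatrix ξ)ᴴ) * τ * basisMatrix ξ := by
        rw [basisMatrix_mul_conjTranspose_self]; simp [inBasis, Matrix.mul_assoc]
    _ = _ := by simp only [inBasis, Matrix.mul_assoc]

theorem inBasis_conj (ξ : OrthonormalBasis n ℂ (EuclideanSpace ℂ n)) (X : Matrix n n ℂ) :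
    inBasis ξ (basisMatrix ξ * X * (basisMatrix ξ)ᴴ) = X := by
  calc inBasis ξ (basisMatrix ξ * X * (basisMatrix ξ)ᴴ)
      = ((basisMatrix ξ)ᴴ * basisMatrix ξ) * X * ((basisMatrix ξ)ᴴ * basisMatrix ξ) := by
        simp only [inBasis, Matrix.mul_assoc]
    _ = X := by simp [conjTranspose_basisMatrix_mul_self]

theorem conj_inBasis (ξ : OrthonormalBasis n ℂ (EuclideanSpace ℂ n)) (σ : Matrix n n ℂ) :
    basisMatrix ξ * inBasis ξ σ * (basisMatrix ξ)ᴴ = σ := by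
  calc basisMatrix ξ * inBasis ξ σ * (basisMatrix ξ)ᴴ
      = (basisMatrix ξ * (basisMatrix ξ)ᴴ) * σ * (basisMatrix ξ * (basisMatrix ξ)ᴴ) := by
        simp only [inBasis, Matrix.mul_assoc]
    _ = σ := by simp [basisMatrix_mul_conjTranspose_self]

theorem trace_inBasis (ξ : OrthonormalBasis n ℂ (EuclideanSpace ℂ n)) (σ : Matrix n n ℂ) :
    (inBasis ξ σ).trace = σ.trace := by
  rw [inBasis, Matrix.trace_mul_comm, ← Matrix.mul_assoc, basisMatrix_mul_conjTranspose_self,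
    Matrix.one_mul]

theorem det_inBasis (ξ : OrthonormalBasis n ℂ (EuclideanSpace ℂ n)) (σ : Matrix n n ℂ) :
    (inBasis ξ σ).det = σ.det := by
  rw [inBasis, Matrix.det_mul_comm, ← Matrix.mul_assoc, basisMatrix_mul_conjTranspose_self,
    Matrix.one_mul]

theorem _root_.Matrix.PosSemidef.inBasis {σ : Matrix n n ℂ} (h : σ.PosSemidef)
    (ξ : OrthonormalBasis n ℂ (EuclideanSpace ℂ n)) :
    (SteeredCoherence.inBasis ξ σ).PosSemidef :=
  h.conjTranspose_mul_mul_same _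

theorem exists_isEigenbasis {σ : Matrix n n ℂ} (h : σ.IsHermitian) :
    ∃ ξ, IsEigenbasis σ ξ := by
  refine ⟨h.eigenvectorBasis, fun i => ⟨h.eigenvalues i, ?_⟩⟩
  ext k
  have := congrFun (h.mulVec_eigenvectorBasis i) k
  simpa using this

theorem coherence_nonneg (σ : Matrix n n ℂ) (ξ : OrthonormalBasis n ℂ (EuclideanSpace ℂ n)) :
    0 ≤ coherence σ ξ := by
  refine Finset.sum_nonneg fun i _ => Finset.sum_nonneg fun j _ => ?_
  split_ifs
  · exact le_rfl
  · exact norm_nonneg _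

theorem maxSteeredCoherenceIn_nonneg (ρ : Matrix (a × n) (a × n) ℂ)
    (ξ : OrthonormalBasis n ℂ (EuclideanSpace ℂ n)) : 0 ≤ maxSteeredCoherenceIn ρ ξ := by
  refine Real.sSup_nonneg ?_
  rintro _ ⟨M, -, -, rfl⟩
  exact coherence_nonneg _ _

theorem maxSteeredCoherence_nonneg (ρ : Matrix (a × n) (a × n) ℂ) :
    0 ≤ maxSteeredCoherence ρ := by
  refine Real.sInf_nonneg ?_
  rintro _ ⟨ξ, -, rfl⟩
  exact maxSteeredCoherenceIn_nonneg _ _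

theorem maxSteeredCoherence_le {ρ : Matrix (a × n) (a × n) ℂ}
    {ξ : OrthonormalBasis n ℂ (EuclideanSpace ℂ n)} (h : IsEigenbasis (trA ρ) ξ) :
    maxSteeredCoherence ρ ≤ maxSteeredCoherenceIn ρ ξ := by
  refine csInf_le ⟨0, ?_⟩ ⟨ξ, h, rfl⟩
  rintro _ ⟨η, -, rfl⟩
  exact maxSteeredCoherenceIn_nonneg _ _

/-! ### Partial trace and steered states -/

theorem posSemidef_trA {X : Matrix (a × n) (a × n) ℂ} (h : X.PosSemidef) :
    (trA X).PosSemidef := by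
  have : trA X = ∑ i, X.submatrix (fun k => (i, k)) (fun k => (i, k)) := by
    ext k l
    simp [trA, Matrix.sum_apply]
  rw [this]
  exact posSemidef_sum _ fun i _ => h.submatrix _

theorem trace_trA (X : Matrix (a × n) (a × n) ℂ) : (trA X).trace = X.trace := by
  simp only [Matrix.trace, trA, Matrix.diag_apply, of_apply]
  rw [Fintype.sum_prod_type, Finset.sum_comm]

theorem trA_kronecker_mul_apply (M : Matrix a a ℂ) (ρ : Matrix (a × n) (a × n) ℂ) (k l : n) :
    trA ((M ⊗ₖ (1 : Matrix n n ℂ)) * ρ) k l = ∑ i, ∑ j, M i j * ρ (j, k) (i, l) := by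
  simp only [trA, of_apply, Matrix.mul_apply, kroneckerMap_apply, Fintype.sum_prod_type]
  refine Finset.sum_congr rfl fun i _ => Finset.sum_congr rfl fun j _ => ?_
  simp [Matrix.one_apply]

/-- Cyclicity of the partial trace for operators on Alice's side; it turns `M = Nᴴ * N` into a
conjugation of `ρ`, which is visibly positive. -/
theorem trA_kronecker_mul_comm (N : Matrix a a ℂ) (X : Matrix (a × n) (a × n) ℂ) :
    trA ((N ⊗ₖ (1 : Matrix n n ℂ)) * X) = trA (X * (N ⊗ₖ (1 : Matrix n n ℂ))) := by
  ext k l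
  rw [trA_kronecker_mul_apply]
  simp only [trA, of_apply, Matrix.mul_apply, kroneckerMap_apply, Fintype.sum_prod_type]
  rw [Finset.sum_comm]
  refine Finset.sum_congr rfl fun i _ => Finset.sum_congr rfl fun j _ => ?_
  simp [Matrix.one_apply, mul_comm]

open scoped MatrixOrder Matrix.Norms.L2Operator in
theorem exists_eq_conjTranspose_mul_self {M : Matrix a a ℂ} (hM : M.PosSemidef) :
    ∃ N : Matrix a a ℂ, M = Nᴴ * N :=
  CStarAlgebra.nonneg_iff_eq_star_mul_self.mp hM.nonneg

theorem posSemidef_trA_kronecker_mul {M : Matrix a a ℂ} (hM : M.PosSemidef)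
    {ρ : Matrix (a × n) (a × n) ℂ} (hρ : ρ.PosSemidef) :
    (trA ((M ⊗ₖ (1 : Matrix n n ℂ)) * ρ)).PosSemidef := by
  obtain ⟨N, rfl⟩ := exists_eq_conjTranspose_mul_self hM
  have h1 : (Nᴴ * N) ⊗ₖ (1 : Matrix n n ℂ)
      = (Nᴴ ⊗ₖ (1 : Matrix n n ℂ)) * (N ⊗ₖ (1 : Matrix n n ℂ)) := by
    rw [← Matrix.mul_kronecker_mul, Matrix.one_mul]
  have h2 : Nᴴ ⊗ₖ (1 : Matrix n n ℂ) = (N ⊗ₖ (1 : Matrix n n ℂ))ᴴ := by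
    rw [Matrix.conjTranspose_kronecker, conjTranspose_one]
  rw [h1, Matrix.mul_assoc, trA_kronecker_mul_comm, h2]
  exact posSemidef_trA (hρ.mul_mul_conjTranspose_same _)

theorem trace_steeredState {ρ : Matrix (a × n) (a × n) ℂ} {M : Matrix a a ℂ}
    (hM : M.PosSemidef) (hρ : ρ.PosSemidef) (hp : 0 < outcomeProb ρ M) :
    (steeredState ρ M).trace = 1 := by
  have h := (posSemidef_trA_kronecker_mul hM hρ).trace_nonneg
  rw [trace_trA] at h
  -- The trace is nonnegative, hence real, so the real part in `outcomeProb` loses nothing.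
  have h' : ((M ⊗ₖ (1 : Matrix n n ℂ)) * ρ).trace = (outcomeProb ρ M : ℂ) :=
    Complex.ext rfl (by simpa using (Complex.nonneg_iff.mp h).2.symm)
  rw [steeredState, Matrix.trace_smul, trace_trA, h', smul_eq_mul, inv_mul_cancel₀]
  exact_mod_cast hp.ne'

theorem isState_steeredState {ρ : Matrix (a × n) (a × n) ℂ} {M : Matrix a a ℂ}
    (hM : M.PosSemidef) (hρ : ρ.PosSemidef) (hp : 0 < outcomeProb ρ M) :
    IsState (steeredState ρ M) := by
  refine ⟨(posSemidef_trA_kronecker_mul hM hρ).smul ?_, trace_steeredState hM hρ hp⟩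
  rw [← Complex.ofReal_inv]
  exact_mod_cast (inv_pos.mpr hp).le

/-! ### Channels acting on Bob's side -/

theorem trA_applyB (Λ : Matrix n n ℂ →ₗ[ℂ] Matrix n n ℂ) (X : Matrix (a × n) (a × n) ℂ) :
    trA (applyB a Λ X) = Λ (trA X) := by
  have : trA X = ∑ i, Matrix.of fun k l => X (i, k) (i, l) := by
    ext k l
    simp [trA, Matrix.sum_apply]
  rw [this, map_sum]
  ext k l
  simp [trA, applyB, Matrix.sum_apply]

theorem trA_kronecker_mul_applyB (Λ : Matrix n n ℂ →ₗ[ℂ] Matrix n n ℂ) (M : Matrix a a ℂ)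
    (X : Matrix (a × n) (a × n) ℂ) :
    trA ((M ⊗ₖ (1 : Matrix n n ℂ)) * applyB a Λ X) =
      Λ (trA ((M ⊗ₖ (1 : Matrix n n ℂ)) * X)) := by
  have : trA ((M ⊗ₖ (1 : Matrix n n ℂ)) * X)
      = ∑ i, ∑ j, M i j • Matrix.of fun k l => X (j, k) (i, l) := by
    ext k l
    simp [trA_kronecker_mul_apply, Matrix.sum_apply]
  rw [this]
  ext k l
  simp [-Matrix.smul_of, trA_kronecker_mul_apply, Matrix.sum_apply, applyB]

theorem outcomeProb_applyB {Λ : Matrix n n ℂ →ₗ[ℂ] Matrix n n ℂ} (hΛ : IsChannel Λ)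
    (X : Matrix (a × n) (a × n) ℂ) (M : Matrix a a ℂ) :
    outcomeProb (applyB a Λ X) M = outcomeProb X M := by
  rw [outcomeProb, ← trace_trA, trA_kronecker_mul_applyB, hΛ.tracePreserving, trace_trA,
    outcomeProb]

theorem steeredState_applyB {Λ : Matrix n n ℂ →ₗ[ℂ] Matrix n n ℂ} (hΛ : IsChannel Λ)
    (X : Matrix (a × n) (a × n) ℂ) (M : Matrix a a ℂ) :
    steeredState (applyB a Λ X) M = Λ (steeredState X M) := by
  rw [steeredState, outcomeProb_applyB hΛ, trA_kronecker_mul_applyB, steeredState, map_smul]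

theorem IsChannel.posSemidef {Λ : Matrix n n ℂ →ₗ[ℂ] Matrix n n ℂ} (hΛ : IsChannel Λ)
    {σ : Matrix n n ℂ} (hσ : σ.PosSemidef) : (Λ σ).PosSemidef := by
  -- Positivity is complete positivity with a one-dimensional ancilla.
  exact (hΛ.completelyPositive 1 (σ.submatrix Prod.snd Prod.snd) (hσ.submatrix _)).submatrix
    (fun k => ((0 : Fin 1), k))

theorem IsState.map {Λ : Matrix n n ℂ →ₗ[ℂ] Matrix n n ℂ} (hΛ : IsChannel Λ)
    {σ : Matrix n n ℂ} (hσ : IsState σ) : IsState (Λ σ) :=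
  ⟨hΛ.posSemidef hσ.1, by rw [hΛ.tracePreserving, hσ.2]⟩

theorem IsState.trA {ρ : Matrix (a × n) (a × n) ℂ} (hρ : IsState ρ) :
    IsState (SteeredCoherence.trA ρ) :=
  ⟨posSemidef_trA hρ.1, by rw [trace_trA, hρ.2]⟩

theorem IsState.applyB {d : ℕ} {Λ : Matrix n n ℂ →ₗ[ℂ] Matrix n n ℂ} (hΛ : IsChannel Λ)
    {ρ : Matrix (Fin d × n) (Fin d × n) ℂ} (hρ : IsState ρ) :
    IsState (SteeredCoherence.applyB (Fin d) Λ ρ) :=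
  ⟨hΛ.completelyPositive d ρ hρ.1, by
    rw [← trace_trA, trA_applyB, hΛ.tracePreserving, trace_trA, hρ.2]⟩

theorem coherence_eq_zero_iff {σ : Matrix n n ℂ}
    {ξ : OrthonormalBasis n ℂ (EuclideanSpace ℂ n)} :
    coherence σ ξ = 0 ↔ IsEigenbasis σ ξ := by
  have hnn : ∀ i j, 0 ≤ if i = j then (0 : ℝ)
      else ‖inner ℂ (ξ i) (Matrix.toEuclideanLin σ (ξ j))‖ := fun i j => by
    split_ifs
    · exact le_rfl
    · exact norm_nonneg _
  rw [isEigenbasis_iff, coherence,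
    Finset.sum_eq_zero_iff_of_nonneg fun i _ => Finset.sum_nonneg fun j _ => hnn i j]
  constructor
  · intro h i j hij
    have := (Finset.sum_eq_zero_iff_of_nonneg fun j _ => hnn i j).mp (h i (Finset.mem_univ _)) j
      (Finset.mem_univ _)
    rwa [if_neg hij, norm_eq_zero, inner_toEuclideanLin_eq_inBasis] at this
  · intro h i _
    refine Finset.sum_eq_zero fun j _ => ?_
    split_ifs with hij
    · rfl
    · rw [inner_toEuclideanLin_eq_inBasis, h i j hij, norm_zero]

theorem IsSemiClassical.maxSteeredCoherence_applyB_le {Λ : Matrix n n ℂ →ₗ[ℂ] Matrix n n ℂ}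
    (hΛ : IsChannel Λ) (h : IsSemiClassical Λ) {ρ : Matrix (a × n) (a × n) ℂ}
    (hρ : IsState ρ) : maxSteeredCoherence (applyB a Λ ρ) ≤ maxSteeredCoherence ρ := by
  obtain ⟨ξ, hξ⟩ := h
  refine le_trans ?_ (maxSteeredCoherence_nonneg ρ)
  have he : IsEigenbasis (trA (applyB a Λ ρ)) ξ := by
    rw [trA_applyB]
    exact coherence_eq_zero_iff.mp (hξ _ hρ.trA)
  refine (maxSteeredCoherence_le he).trans (Real.sSup_le ?_ le_rfl)
  rintro _ ⟨M, hM, hp, rfl⟩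
  rw [outcomeProb_applyB hΛ] at hp
  rw [steeredState_applyB hΛ, hξ _ (isState_steeredState hM.1 hρ.1 hp)]

end General

/-! ### Qubit coherence -/

section Qubit

theorem coherence_fin_two (σ : Matrix (Fin 2) (Fin 2) ℂ)
    (ξ : OrthonormalBasis (Fin 2) ℂ (EuclideanSpace ℂ (Fin 2))) :
    coherence σ ξ = ‖inBasis ξ σ 0 1‖ + ‖inBasis ξ σ 1 0‖ := by
  simp [coherence, Fin.sum_univ_two, inner_toEuclideanLin_eq_inBasis]

theorem isEigenbasis_fin_two {σ : Matrix (Fin 2) (Fin 2) ℂ}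
    {ξ : OrthonormalBasis (Fin 2) ℂ (EuclideanSpace ℂ (Fin 2))} :
    IsEigenbasis σ ξ ↔ inBasis ξ σ 0 1 = 0 ∧ inBasis ξ σ 1 0 = 0 := by
  simp [isEigenbasis_iff, Fin.forall_fin_two]

theorem norm_apply_one_zero {σ : Matrix (Fin 2) (Fin 2) ℂ} (h : σ.IsHermitian) :
    ‖σ 1 0‖ = ‖σ 0 1‖ := by
  rw [← h.apply 1 0, norm_star]

theorem coherence_eq_two_mul {σ : Matrix (Fin 2) (Fin 2) ℂ} (h : σ.PosSemidef)
    (ξ : OrthonormalBasis (Fin 2) ℂ (EuclideanSpace ℂ (Fin 2))) :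
    coherence σ ξ = 2 * ‖inBasis ξ σ 0 1‖ := by
  rw [coherence_fin_two, norm_apply_one_zero (h.inBasis ξ).isHermitian, two_mul]

/-- A nonnegative determinant bounds `‖σ 0 1‖ ^ 2` by the product of the diagonal entries; conclude
by AM-GM. -/
theorem two_mul_norm_le_trace {σ : Matrix (Fin 2) (Fin 2) ℂ} (h : σ.PosSemidef) :
    2 * ‖σ 0 1‖ ≤ σ.trace.re := by
  have h0 := Complex.nonneg_iff.mp (h.diag_nonneg (i := 0))
  have h1 := Complex.nonneg_iff.mp (h.diag_nonneg (i := 1))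
  have hd := (Complex.nonneg_iff.mp h.det_nonneg).1
  have h10 : σ 1 0 = star (σ 0 1) := (h.isHermitian.apply 1 0).symm
  have hn : σ 0 1 * star (σ 0 1) = ((‖σ 0 1‖ ^ 2 : ℝ) : ℂ) := by
    rw [Complex.star_def, Complex.mul_conj, Complex.normSq_eq_norm_sq]
  rw [Matrix.det_fin_two, h10, hn, Complex.sub_re, Complex.ofReal_re, Complex.mul_re, ← h0.2,
    ← h1.2] at hd
  rw [Matrix.trace_fin_two, Complex.add_re]
  nlinarith [norm_nonneg (σ 0 1), sq_nonneg ((σ 0 0).re - (σ 1 1).re), h0.1, h1.1]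

theorem coherence_le_trace {σ : Matrix (Fin 2) (Fin 2) ℂ} (h : σ.PosSemidef)
    (ξ : OrthonormalBasis (Fin 2) ℂ (EuclideanSpace ℂ (Fin 2))) :
    coherence σ ξ ≤ σ.trace.re := by
  rw [coherence_eq_two_mul h, ← trace_inBasis ξ]
  exact two_mul_norm_le_trace (h.inBasis ξ)

theorem le_maxSteeredCoherenceIn {a : Type*} [Fintype a] [DecidableEq a]
    {ρ : Matrix (a × Fin 2) (a × Fin 2) ℂ} (hρ : ρ.PosSemidef)
    (ξ : OrthonormalBasis (Fin 2) ℂ (EuclideanSpace ℂ (Fin 2))) {M : Matrix a a ℂ}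
    (hM : IsPOVMElement M) (hp : 0 < outcomeProb ρ M) :
    coherence (steeredState ρ M) ξ ≤ maxSteeredCoherenceIn ρ ξ := by
  -- Coherence is at most the trace, which is 1: the supremum is over a bounded set.
  refine le_csSup ⟨1, ?_⟩ ⟨M, hM, hp, rfl⟩
  rintro _ ⟨N, hN, hq, rfl⟩
  have h := isState_steeredState hN.1 hρ hq
  simpa [h.2] using coherence_le_trace h.1 ξ

/-! ### Unital channels -/

/-- Matrices differing by one for which `ξ` is an eigenbasis have the same coherence in `ξ`. -/
theorem coherence_congr {σ τ : Matrix (Fin 2) (Fin 2) ℂ}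
    {ξ : OrthonormalBasis (Fin 2) ℂ (EuclideanSpace ℂ (Fin 2))} (h : IsEigenbasis (σ - τ) ξ) :
    coherence σ ξ = coherence τ ξ := by
  rw [isEigenbasis_fin_two, inBasis_sub, Matrix.sub_apply, Matrix.sub_apply, sub_eq_zero,
    sub_eq_zero] at h
  rw [coherence_fin_two, coherence_fin_two, h.1, h.2]

/-- A positive matrix with the same off-diagonal part as `σ` in the basis `ξ`, whose trace is the
coherence of `σ`. -/
theorem exists_posSemidef_trace_eq_coherence {σ : Matrix (Fin 2) (Fin 2) ℂ} (h : σ.PosSemidef)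
    (ξ : OrthonormalBasis (Fin 2) ℂ (EuclideanSpace ℂ (Fin 2))) :
    ∃ Y : Matrix (Fin 2) (Fin 2) ℂ, Y.PosSemidef ∧ Y.trace = (coherence σ ξ : ℂ) ∧
      IsEigenbasis (σ - Y) ξ := by
  set c := inBasis ξ σ 0 1 with hc
  have hc' : inBasis ξ σ 1 0 = star c := ((h.inBasis ξ).isHermitian.apply 1 0).symm
  have hpos : (!![(‖c‖ : ℂ), c; star c, (‖c‖ : ℂ)]).PosSemidef := by
    by_cases h0 : c = 0
    · have : !![(‖c‖ : ℂ), c; star c, (‖c‖ : ℂ)] = 0 := by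
        ext i j
        fin_cases i <;> fin_cases j <;> simp [h0]
      rw [this]
      exact PosSemidef.zero
    · have hne : (‖c‖ : ℂ) ≠ 0 := by simpa using h0
      have hcc : star c * c = (‖c‖ : ℂ) ^ 2 := by
        rw [Complex.star_def, mul_comm, Complex.mul_conj, Complex.normSq_eq_norm_sq]
        push_cast
        rfl
      -- The matrix has determinant zero, so for `c ≠ 0` it is a positive multiple of a rank-one
      -- projection.
      have : !![(‖c‖ : ℂ), c; star c, (‖c‖ : ℂ)]
          = ((‖c‖ : ℂ)⁻¹) • vecMulVec ![(‖c‖ : ℂ), star c] (star ![(‖c‖ : ℂ), star c]) := by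
        ext i j
        rw [Matrix.smul_apply, vecMulVec_apply, smul_eq_mul, eq_inv_mul_iff_mul_eq₀ hne]
        fin_cases i <;> fin_cases j <;> simp
        · ring
        · simpa [sq] using hcc.symm
      rw [this]
      refine (posSemidef_vecMulVec_self_star _).smul ?_
      rw [← Complex.ofReal_inv]
      exact_mod_cast inv_nonneg.mpr (norm_nonneg c)
  refine ⟨basisMatrix ξ * !![(‖c‖ : ℂ), c; star c, (‖c‖ : ℂ)] * (basisMatrix ξ)ᴴ,
    hpos.mul_mul_conjTranspose_same _, ?_, ?_⟩
  · rw [← trace_inBasis ξ, inBasis_conj, coherence_eq_two_mul h, Matrix.trace_fin_two]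
    simp [hc, two_mul]
  · rw [isEigenbasis_fin_two, inBasis_sub, inBasis_conj]
    simp [← hc, hc']

/-- The projection on the first vector of a basis. -/
noncomputable def firstProj (ξ : OrthonormalBasis (Fin 2) ℂ (EuclideanSpace ℂ (Fin 2))) :
    Matrix (Fin 2) (Fin 2) ℂ :=
  basisMatrix ξ * !![1, 0; 0, 0] * (basisMatrix ξ)ᴴ

theorem posSemidef_firstProj (ξ : OrthonormalBasis (Fin 2) ℂ (EuclideanSpace ℂ (Fin 2))) :
    (firstProj ξ).PosSemidef := by
  refine PosSemidef.mul_mul_conjTranspose_same ?_ _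
  have : (!![1, 0; 0, 0] : Matrix (Fin 2) (Fin 2) ℂ) = Matrix.diagonal ![1, 0] := by
    ext i j
    fin_cases i <;> fin_cases j <;> simp
  rw [this, posSemidef_diagonal_iff]
  simp [Fin.forall_fin_two]

/-- In dimension two the diagonal matrices are spanned by one projection and the identity, so a
unital map is controlled on all of them by its value at that projection. -/
theorem IsEigenbasis.eq_smul_firstProj_add {σ : Matrix (Fin 2) (Fin 2) ℂ}
    {ξ : OrthonormalBasis (Fin 2) ℂ (EuclideanSpace ℂ (Fin 2))} (h : IsEigenbasis σ ξ) :
    ∃ x y : ℂ, σ = x • firstProj ξ + y • 1 := by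
  rw [isEigenbasis_fin_two] at h
  refine ⟨inBasis ξ σ 0 0 - inBasis ξ σ 1 1, inBasis ξ σ 1 1, ?_⟩
  rw [← conj_inBasis ξ σ, ← conj_inBasis ξ (_ + _)]
  congr 2
  rw [conj_inBasis, inBasis_add, inBasis_smul, inBasis_smul, inBasis_one, firstProj, inBasis_conj]
  ext i j
  fin_cases i <;> fin_cases j <;> simp [h.1, h.2]

theorem IsEigenbasis.map {Λ : Matrix (Fin 2) (Fin 2) ℂ →ₗ[ℂ] Matrix (Fin 2) (Fin 2) ℂ}
    (hu : IsUnital Λ) {ξ η : OrthonormalBasis (Fin 2) ℂ (EuclideanSpace ℂ (Fin 2))}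
    (hη : IsEigenbasis (Λ (firstProj ξ)) η) {σ : Matrix (Fin 2) (Fin 2) ℂ}
    (h : IsEigenbasis σ ξ) : IsEigenbasis (Λ σ) η := by
  obtain ⟨x, y, rfl⟩ := h.eq_smul_firstProj_add
  rw [isEigenbasis_fin_two] at hη ⊢
  rw [map_add, map_smul, map_smul, hu, inBasis_add, inBasis_smul, inBasis_smul, inBasis_one]
  simp [hη.1, hη.2]

theorem IsUnital.coherence_map_le
    {Λ : Matrix (Fin 2) (Fin 2) ℂ →ₗ[ℂ] Matrix (Fin 2) (Fin 2) ℂ} (hΛ : IsChannel Λ)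
    (hu : IsUnital Λ) {ξ η : OrthonormalBasis (Fin 2) ℂ (EuclideanSpace ℂ (Fin 2))}
    (hη : IsEigenbasis (Λ (firstProj ξ)) η) {σ : Matrix (Fin 2) (Fin 2) ℂ}
    (hσ : σ.PosSemidef) : coherence (Λ σ) η ≤ coherence σ ξ := by
  obtain ⟨Y, hY, htr, hd⟩ := exists_posSemidef_trace_eq_coherence hσ ξ
  have hd' := IsEigenbasis.map hu hη hd
  rw [map_sub] at hd'
  rw [coherence_congr hd']
  refine (coherence_le_trace (hΛ.posSemidef hY) η).trans_eq ?_
  rw [hΛ.tracePreserving, htr, Complex.ofReal_re]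

theorem IsUnital.maxSteeredCoherence_applyB_le {a : Type*} [Fintype a] [DecidableEq a]
    {Λ : Matrix (Fin 2) (Fin 2) ℂ →ₗ[ℂ] Matrix (Fin 2) (Fin 2) ℂ} (hΛ : IsChannel Λ)
    (hu : IsUnital Λ) {ρ : Matrix (a × Fin 2) (a × Fin 2) ℂ} (hρ : IsState ρ) :
    maxSteeredCoherence (applyB a Λ ρ) ≤ maxSteeredCoherence ρ := by
  obtain ⟨ξ₀, hξ₀⟩ := exists_isEigenbasis hρ.trA.1.isHermitian
  refine le_csInf ⟨_, ξ₀, hξ₀, rfl⟩ ?_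
  rintro _ ⟨ξ, hξ, rfl⟩
  -- The basis `η` depends on `ξ`: each term of the infimum for `ρ` is matched by one for the output
  -- that is no larger.
  obtain ⟨η, hη⟩ := exists_isEigenbasis (hΛ.posSemidef (posSemidef_firstProj ξ)).isHermitian
  have he : IsEigenbasis (trA (applyB a Λ ρ)) η := by
    rw [trA_applyB]
    exact IsEigenbasis.map hu hη hξ
  refine (maxSteeredCoherence_le he).trans
    (Real.sSup_le ?_ (maxSteeredCoherenceIn_nonneg _ _))
  rintro _ ⟨M, hM, hp, rfl⟩
  rw [outcomeProb_applyB hΛ] at hp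
  rw [steeredState_applyB hΛ]
  exact (hu.coherence_map_le hΛ hη (isState_steeredState hM.1 hρ.1 hp).1).trans
    (le_maxSteeredCoherenceIn hρ.1 ξ hM hp)

/-! ### Independence of the eigenbasis -/

/-- With `τ` diagonal, the commutator has zero diagonal and off-diagonal entries those of `σ` times
plus or minus the eigenvalue gap, whose square is the discriminant. The right side does not involve
`ξ`. -/
theorem disc_mul_eq_det_commutator {τ : Matrix (Fin 2) (Fin 2) ℂ}
    {ξ : OrthonormalBasis (Fin 2) ℂ (EuclideanSpace ℂ (Fin 2))} (h : IsEigenbasis τ ξ)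
    (σ : Matrix (Fin 2) (Fin 2) ℂ) :
    (τ.trace ^ 2 - 4 * τ.det) * (inBasis ξ σ 0 1 * inBasis ξ σ 1 0) =
      (τ * σ - σ * τ).det := by
  rw [isEigenbasis_fin_two] at h
  rw [← trace_inBasis ξ τ, ← det_inBasis ξ τ, ← det_inBasis ξ (_ - _), inBasis_sub, inBasis_mul,
    inBasis_mul]
  simp only [Matrix.det_fin_two, Matrix.trace_fin_two, Matrix.sub_apply, Matrix.mul_apply,
    Fin.sum_univ_two, h.1, h.2]
  ring

theorem disc_ne_zero {τ : Matrix (Fin 2) (Fin 2) ℂ}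
    {ξ : OrthonormalBasis (Fin 2) ℂ (EuclideanSpace ℂ (Fin 2))} (h : IsEigenbasis τ ξ)
    (hτ : ∀ c : ℂ, τ ≠ c • 1) : τ.trace ^ 2 - 4 * τ.det ≠ 0 := by
  intro h0
  rw [← trace_inBasis ξ τ, ← det_inBasis ξ τ, Matrix.det_fin_two, Matrix.trace_fin_two] at h0
  obtain ⟨h1, h2⟩ := isEigenbasis_fin_two.mp h
  rw [h1, h2] at h0
  have h3 : inBasis ξ τ 0 0 = inBasis ξ τ 1 1 := by
    have : (inBasis ξ τ 0 0 - inBasis ξ τ 1 1) ^ 2 = 0 := by linear_combination h0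
    exact sub_eq_zero.mp (pow_eq_zero_iff two_ne_zero |>.mp this)
  refine hτ (inBasis ξ τ 0 0) ?_
  have h4 : inBasis ξ τ = inBasis ξ τ 0 0 • (1 : Matrix (Fin 2) (Fin 2) ℂ) := by
    ext i j
    fin_cases i <;> fin_cases j <;> simp [h1, h2, h3]
  rw [← conj_inBasis ξ τ, h4, inBasis_conj]
  simp [basisMatrix_mul_conjTranspose_self]

theorem coherence_sq {σ : Matrix (Fin 2) (Fin 2) ℂ} (h : σ.PosSemidef)
    (ξ : OrthonormalBasis (Fin 2) ℂ (EuclideanSpace ℂ (Fin 2))) :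
    coherence σ ξ ^ 2 = 4 * ‖inBasis ξ σ 0 1 * inBasis ξ σ 1 0‖ := by
  rw [coherence_eq_two_mul h, norm_mul, norm_apply_one_zero (h.inBasis ξ).isHermitian]
  ring

/-- The coherence is the same in all eigenbases of a nondegenerate matrix. -/
theorem coherence_eq_of_isEigenbasis {τ σ : Matrix (Fin 2) (Fin 2) ℂ}
    (hτ : ∀ c : ℂ, τ ≠ c • 1) (hσ : σ.PosSemidef)
    {ξ η : OrthonormalBasis (Fin 2) ℂ (EuclideanSpace ℂ (Fin 2))} (hξ : IsEigenbasis τ ξ)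
    (hη : IsEigenbasis τ η) : coherence σ ξ = coherence σ η := by
  have h := (disc_mul_eq_det_commutator hξ σ).trans (disc_mul_eq_det_commutator hη σ).symm
  have h' := mul_left_cancel₀ (disc_ne_zero hξ hτ) h
  refine (pow_left_inj₀ (coherence_nonneg _ _) (coherence_nonneg _ _) two_ne_zero).mp ?_
  rw [coherence_sq hσ, coherence_sq hσ, h']

/-! ### Raising the coherence -/

theorem IsState.one_sub {σ : Matrix (Fin 2) (Fin 2) ℂ} (h : IsState σ) : IsState (1 - σ) := by
  refine ⟨?_, by rw [Matrix.trace_sub, h.2]; simp; norm_num⟩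
  -- For trace one, `1 - σ` is the adjugate of `σ` (the qubit spin flip).
  have : 1 - σ = !![0, 1; -1, 0]ᴴ * σᵀ * !![0, 1; -1, 0] := by
    have ht := h.2
    rw [Matrix.trace_fin_two] at ht
    ext i j
    fin_cases i <;> fin_cases j <;>
      simp [Matrix.mul_apply, Fin.sum_univ_two]
    · linear_combination -ht
    · linear_combination -ht
  rw [this]
  exact h.1.transpose.conjTranspose_mul_mul_same _

/-- Alice's two outcomes, equally likely, prepare `σ` or `1 - σ` on Bob's side. -/
noncomputable def complementaryState (σ : Matrix (Fin 2) (Fin 2) ℂ) :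
    Matrix (Fin 2 × Fin 2) (Fin 2 × Fin 2) ℂ :=
  (1 / 2 : ℂ) • (Matrix.single 0 0 1 ⊗ₖ σ + Matrix.single 1 1 1 ⊗ₖ (1 - σ))

theorem zero_le_one_half : (0 : ℂ) ≤ 1 / 2 := by
  rw [Complex.nonneg_iff]
  norm_num

theorem posSemidef_single (i : Fin 2) :
    (Matrix.single i i (1 : ℂ)).PosSemidef := by
  rw [← Matrix.diagonal_single, posSemidef_diagonal_iff]
  intro j
  by_cases h : j = i
  · subst h; simp
  · simp [h]

theorem trA_kronecker_mul_complementaryState (M σ : Matrix (Fin 2) (Fin 2) ℂ) :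
    trA ((M ⊗ₖ (1 : Matrix (Fin 2) (Fin 2) ℂ)) * complementaryState σ) =
      (1 / 2 : ℂ) • (M 0 0 • σ + M 1 1 • (1 - σ)) := by
  ext k l
  rw [trA_kronecker_mul_apply]
  simp [complementaryState, Fin.sum_univ_two, Matrix.single_apply]
  ring

theorem trA_complementaryState (σ : Matrix (Fin 2) (Fin 2) ℂ) :
    trA (complementaryState σ) = (1 / 2 : ℂ) • 1 := by
  have := trA_kronecker_mul_complementaryState 1 σ
  simpa using this

theorem isState_complementaryState {σ : Matrix (Fin 2) (Fin 2) ℂ} (h : IsState σ) :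
    IsState (complementaryState σ) := by
  refine ⟨PosSemidef.smul (((posSemidef_single 0).kronecker h.1).add
    ((posSemidef_single 1).kronecker h.one_sub.1)) ?_, ?_⟩
  · exact zero_le_one_half
  · rw [← trace_trA, trA_complementaryState]
    simp

theorem maxSteeredCoherence_complementaryState {σ : Matrix (Fin 2) (Fin 2) ℂ}
    (h : IsState σ) : maxSteeredCoherence (complementaryState σ) ≤ 0 := by
  -- Every basis is an eigenbasis of the reduced state; one that diagonalizes `σ` diagonalizes all
  -- steered states, which are combinations of `σ` and `1`.
  obtain ⟨ξ, hξ⟩ := exists_isEigenbasis h.1.isHermitian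
  have he : IsEigenbasis (trA (complementaryState σ)) ξ := by
    rw [trA_complementaryState, isEigenbasis_fin_two, inBasis_smul, inBasis_one]
    simp
  refine (maxSteeredCoherence_le he).trans (Real.sSup_le ?_ le_rfl)
  rintro _ ⟨M, -, -, rfl⟩
  refine (coherence_eq_zero_iff.mpr ?_).le
  rw [isEigenbasis_fin_two] at hξ ⊢
  rw [steeredState, trA_kronecker_mul_complementaryState]
  simp only [inBasis_smul, inBasis_add, inBasis_sub, inBasis_one]
  simp [hξ.1, hξ.2]

theorem outcomeProb_complementaryState {σ : Matrix (Fin 2) (Fin 2) ℂ} (h : IsState σ) :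
    outcomeProb (complementaryState σ) (Matrix.single 0 0 1) = 1 / 2 := by
  rw [outcomeProb, ← trace_trA, trA_kronecker_mul_complementaryState]
  simp [h.2]

theorem steeredState_complementaryState {σ : Matrix (Fin 2) (Fin 2) ℂ} (h : IsState σ) :
    steeredState (complementaryState σ) (Matrix.single 0 0 1) = σ := by
  rw [steeredState, outcomeProb_complementaryState h, trA_kronecker_mul_complementaryState]
  simp

theorem isPOVMElement_single : IsPOVMElement (Matrix.single (0 : Fin 2) 0 (1 : ℂ)) := by
  refine ⟨posSemidef_single 0, ?_⟩
  have : 1 - Matrix.single (0 : Fin 2) (0 : Fin 2) (1 : ℂ) = Matrix.single 1 1 1 := by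
    ext i j
    fin_cases i <;> fin_cases j <;> simp
  rw [this]
  exact posSemidef_single 1

theorem exists_maxSteeredCoherence_lt
    {Λ : Matrix (Fin 2) (Fin 2) ℂ →ₗ[ℂ] Matrix (Fin 2) (Fin 2) ℂ} (hΛ : IsChannel Λ)
    (hu : ¬ IsUnital Λ) (hs : ¬ IsSemiClassical Λ) :
    ∃ ρ : Matrix (Fin 2 × Fin 2) (Fin 2 × Fin 2) ℂ, IsState ρ ∧
      maxSteeredCoherence ρ < maxSteeredCoherence (applyB (Fin 2) Λ ρ) := by
  -- If `Λ (1/2)` were scalar, its trace would force it to be `1/2`, making `Λ` unital.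
  have hnd : ∀ c : ℂ, Λ ((1 / 2 : ℂ) • 1) ≠ c • 1 := by
    intro c hc
    have ht := congrArg Matrix.trace hc
    rw [hΛ.tracePreserving] at ht
    have hc' : c = 1 / 2 := by
      simp at ht
      linear_combination -(1 / 2 : ℂ) * ht
    rw [map_smul, hc'] at hc
    exact hu (smul_right_injective _ (by norm_num : (1 / 2 : ℂ) ≠ 0) hc)
  obtain ⟨ξ, hξ⟩ := exists_isEigenbasis (hΛ.posSemidef
    (PosSemidef.one.smul zero_le_one_half)).isHermitian
  obtain ⟨σ, hσ, hne⟩ : ∃ σ, IsState σ ∧ coherence (Λ σ) ξ ≠ 0 := by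
    by_contra! hcon
    exact hs ⟨ξ, hcon⟩
  have hρ := isState_complementaryState hσ
  refine ⟨complementaryState σ, hρ, (maxSteeredCoherence_complementaryState hσ).trans_lt
    ((lt_of_le_of_ne (coherence_nonneg _ _) hne.symm).trans_le ?_)⟩
  have htr : trA (applyB (Fin 2) Λ (complementaryState σ)) = Λ ((1 / 2 : ℂ) • 1) := by
    rw [trA_applyB, trA_complementaryState]
  refine le_csInf ⟨_, ξ, htr ▸ hξ, rfl⟩ ?_
  rintro _ ⟨η, hη, rfl⟩
  rw [htr] at hη
  rw [coherence_eq_of_isEigenbasis hnd (hσ.map hΛ).1 hξ hη]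
  have hp : 0 < outcomeProb (applyB (Fin 2) Λ (complementaryState σ)) (Matrix.single 0 0 1) := by
    rw [outcomeProb_applyB hΛ, outcomeProb_complementaryState hσ]
    norm_num
  have hle := le_maxSteeredCoherenceIn (hρ.applyB hΛ).1 η isPOVMElement_single hp
  rwa [steeredState_applyB hΛ, steeredState_complementaryState hσ] at hle

end Qubit

end SteeredCoherence

theorem theorem1 (Λ : Matrix (Fin 2) (Fin 2) ℂ →ₗ[ℂ] Matrix (Fin 2) (Fin 2) ℂ)
    (hΛ : SteeredCoherence.IsChannel Λ) :
    (∃ ρ : Matrix (Fin 2 × Fin 2) (Fin 2 × Fin 2) ℂ, SteeredCoherence.IsState ρ ∧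
      SteeredCoherence.maxSteeredCoherence ρ <
        SteeredCoherence.maxSteeredCoherence (SteeredCoherence.applyB (Fin 2) Λ ρ)) ↔
    (¬ SteeredCoherence.IsUnital Λ ∧ ¬ SteeredCoherence.IsSemiClassical Λ) := by
  constructor
  · rintro ⟨ρ, hρ, hlt⟩
    exact ⟨fun hu => (hu.maxSteeredCoherence_applyB_le hΛ hρ).not_gt hlt,
      fun hs => (hs.maxSteeredCoherence_applyB_le hΛ hρ).not_gt hlt⟩
  · rintro ⟨hu, hs⟩
    exact SteeredCoherence.exists_maxSteeredCoherence_lt hΛ hu hs
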